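/- Let $\ell\ge 1$ and let $w_0=k,w_1,\dots,w_\ell=d$ be the widths. For each layer $j\in\{1,\dots,\ell\}$ let $\sigma_j:\mathbb{R}^{w_j}\to\mathbb{R}^{w_j}$ be an activation function with $\sigma_j(\mathbf 0)=\mathbf 0$ that is $L_j$-Lipschitz with respect to the $\ell_2$ norm, let $M_j>0$, and let $\mathcal{A}_j\subseteq\{A\in\mathbb{R}^{w_j\times w_{j-1}} : \sum_{i,m}|A_{im}|\le M_j\}$ be an arbitrary fixed set of weight matrices. Let $\mathcal{H}\subset\mathbb{R}^k$ be a nonempty compact set, $\|\mathcal{H}\|_\infty:=\sup_{h\in\mathcal{H}}\|h\|$, and let $\mathcal{Z}\subset\mathbb{R}^d$ be compact and convex with $\mathbf 0\in\mathcal{Z}$. For $A_{1:\ell}=(A_1,\dots,A_\ell)$ let $$f_\ell(h;A_{1:\ell}) := \sigma_\ell\big(A_\ell\,\sigma_{\ell-1}(A_{\ell-1}\cdots\sigma_1(A_1h)\cdots)\big),\qquad \mathcal{F}_\ell:=\{\pi_{\mathcal{Z}}\circ f_\ell(\cdot;A_{1:\ell}) : A_j\in\mathcal{A}_j,\ 1\le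 j\le\ell\},$$ where $\pi_{\mathcal{Z}}(\xi):=\arg\min_{z\in\mathcal{Z}}\|\xi-z\|$. Let $P$ be a Borel probability measure on $\mathbb{R}^d$ supported on $\mathcal{Z}$ (that is, $P(\mathcal{Z})=1$), let $n\ge1$, let $Z_1,\dots,Z_n$ be independent random vectors with law $P$, and let $P_n:=\frac1n\sum_{i=1}^n\delta_{Z_i}$ be their empirical distribution. For a probability measure $Q$ on $\mathbb{R}^d$ and $f\in\mathcal{F}_\ell$ put $\mathcal{R}(Q,f):=\int\min_{h\in\mathcal{H}}\|z-f(h)\|^2\,Q(\mathrm{d}z)$, and let $$\mathsf{gen}(\mathcal{F}_\ell):=\sup_{f\in\mathcal{F}_\ell}\big|\mathcal{R}(P,f)-\mathcal{R}(P_n,f)\big| .$$ Theorem (wide net). For every $\delta\in(0,1)$, with probability at least $1-\delta$ over $Z_1,\dots,Z_n$, $$\mathsf{gen}(\mathcal{F}_\ell)\le\frac{48\sqrt2\,\ell\log n}{\sqrt n}\,\mathsf{diam}(\mathcal{Z})\,\|\mathcal{H}\|_\infty\Big(\prod_{j=1}^\ell L_jM_j\Big)\sqrt{\sum_{j=1}^\ell\log(2w_{j-1}w_j+1)}+\frac{8\,\mathsf{diam}^2(\mathcal{Z})}{\sqrt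 n}+\mathsf{diam}^2(\mathcal{Z})\sqrt{\frac{2\log(2/\delta)}{n}} .$$ In particular, the bound depends on the widths only logarithmically. (The supremum over an empty class is read as $0$; logarithms are natural.) -/

import Mathlib

open MeasureTheory ProbabilityTheory
open scoped NNReal ENNReal Matrix

noncomputable section

/-- Euclidean space `ℝᵐ` with the `ℓ₂` norm. -/
abbrev Euc (m : ℕ) : Type := EuclideanSpace ℝ (Fin m)

/-- The entrywise `ℓ₁` norm of a matrix. -/
def entrywiseL1 {m k : ℕ} (A : Matrix (Fin m) (Fin k) ℝ) : ℝ :=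
  ∑ i, ∑ j, |A i j|

/-- `‖U‖_∞ = sup_{u ∈ U} ‖u‖` for a set `U` of vectors. -/
def supNorm {m : ℕ} (U : Set (Euc m)) : ℝ :=
  ⨆ u : U, ‖(u : Euc m)‖

/-- One fully connected layer, `ξ ↦ σ(A ξ)`. -/
def denseLayer {m k : ℕ} (σ : Euc m → Euc m) (A : Matrix (Fin m) (Fin k) ℝ) (ξ : Euc k) :
    Euc m :=
  σ (WithLp.toLp 2 (A *ᵥ ξ.ofLp))

/-- The fully connected net of depth `l` with widths `w 0, …, w l`. Layers are numbered from `0`: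
the layer from width `w j` to width `w (j + 1)` has activation `σ j` and weight matrix `A j`, and
only the entries `j < l` of the sequences `σ` and `A` are used. -/
def denseNet (w : ℕ → ℕ) (σ : ∀ j, Euc (w (j + 1)) → Euc (w (j + 1)))
    (A : ∀ j, Matrix (Fin (w (j + 1))) (Fin (w j)) ℝ) : ∀ l : ℕ, Euc (w 0) → Euc (w l)
  | 0, h => h
  | l + 1, h => denseLayer (σ l) (A l) (denseNet w σ A l h)

/-- `p` is a point of `Z` nearest to `ξ`. -/
def IsNearestPoint {m : ℕ} (Z : Set (Euc m)) (ξ p : Euc m) : Prop :=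
  p ∈ Z ∧ ∀ z ∈ Z, ‖ξ - p‖ ≤ ‖ξ - z‖

/-- The projection `π_Z(ξ) = argmin_{z ∈ Z} ‖ξ - z‖`. The minimizer exists and is unique when `Z`
is nonempty, closed and convex; see `projOnto_eq_iff`. -/
def projOnto {m : ℕ} (Z : Set (Euc m)) (ξ : Euc m) : Euc m :=
  Classical.epsilon (IsNearestPoint Z ξ)

theorem isNearestPoint_projOnto {m : ℕ} {Z : Set (Euc m)} (hne : Z.Nonempty) (hcl : IsClosed Z)
    (ξ : Euc m) : IsNearestPoint Z ξ (projOnto Z ξ) := by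
  apply Classical.epsilon_spec (p := IsNearestPoint Z ξ)
  obtain ⟨p, hp, h⟩ := hcl.exists_infDist_eq_dist hne ξ
  refine ⟨p, hp, fun z hz => ?_⟩
  rw [← dist_eq_norm, ← dist_eq_norm, ← h]
  exact Metric.infDist_le_dist_of_mem hz

theorem projOnto_eq_iff {m : ℕ} {Z : Set (Euc m)} (hne : Z.Nonempty) (hcl : IsClosed Z)
    (hconv : Convex ℝ Z) (ξ p : Euc m) : projOnto Z ξ = p ↔ IsNearestPoint Z ξ p := by
  constructor
  · rintro rfl
    exact isNearestPoint_projOnto hne hcl ξ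
  · intro hp
    have hq := isNearestPoint_projOnto hne hcl ξ
    have key : ∀ a, IsNearestPoint Z ξ a → ∀ z ∈ Z, inner ℝ (ξ - a) (z - a) ≤ 0 := by
      intro a ha
      have : Nonempty Z := hne.to_subtype
      refine (norm_eq_iInf_iff_real_inner_le_zero hconv ha.1).1 (le_antisymm ?_ ?_)
      · exact le_ciInf fun z => ha.2 z z.2
      · exact ciInf_le ⟨0, by rintro _ ⟨z, rfl⟩; positivity⟩ (⟨a, ha.1⟩ : Z)
    have h1 := key p hp _ hq.1
    have h2 := key _ hq p hp.1
    have h3 : inner ℝ (projOnto Z ξ - p) (projOnto Z ξ - p) ≤ 0 := by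
      have e : inner ℝ (projOnto Z ξ - p) (projOnto Z ξ - p)
          = inner ℝ (ξ - p) (projOnto Z ξ - p)
            + inner ℝ (ξ - projOnto Z ξ) (p - projOnto Z ξ) := by
        simp only [inner_sub_left, inner_sub_right, real_inner_comm]
        ring
      rw [e]; linarith
    exact sub_eq_zero.1 (real_inner_self_nonpos.1 h3)

/-- The class `𝓕_ℓ` of reconstruction maps `π_Z ∘ f_ℓ(· ; A₁, …, A_ℓ)`, the weight matrix of each
layer ranging over the parameter set of that layer. -/
def denseNetClass (w : ℕ → ℕ) (l : ℕ) (σ : ∀ j, Euc (w (j + 1)) → Euc (w (j + 1)))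
    (𝒜 : ∀ j, Set (Matrix (Fin (w (j + 1))) (Fin (w j)) ℝ)) (Z : Set (Euc (w l))) :
    Set (Euc (w 0) → Euc (w l)) :=
  {f | ∃ A : ∀ j, Matrix (Fin (w (j + 1))) (Fin (w j)) ℝ,
    (∀ j < l, A j ∈ 𝒜 j) ∧ f = fun h => projOnto Z (denseNet w σ A l h)}

/-- The minimal reconstruction error `e_f(z) = min_{h ∈ H} ‖z - f(h)‖²`; for `H` compact and
nonempty and `f` continuous the infimum is attained. -/
def minError {k d : ℕ} (H : Set (Euc k)) (f : Euc k → Euc d) (z : Euc d) : ℝ :=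
  ⨅ h : H, ‖z - f h‖ ^ 2

/-- The expected reconstruction error `R(P, f) = E_P[e_f(Z)]`. -/
def risk {k d : ℕ} (H : Set (Euc k)) (P : Measure (Euc d)) (f : Euc k → Euc d) : ℝ :=
  ∫ z, minError H f z ∂P

/-- The empirical distribution `P_n = (1/n) ∑ δ_{z_i}` of a sample. -/
def empiricalMeasure {d n : ℕ} (z : Fin n → Euc d) : Measure (Euc d) :=
  (n : ℝ≥0∞)⁻¹ • ∑ i, Measure.dirac (z i)

/-- The generalization error `gen(P, 𝓕) = sup_{f ∈ 𝓕} |R(P, f) - R(P_n, f)|` on the sample `z`, as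
a supremum in `[0, ∞]`. -/
def genError {k d n : ℕ} (H : Set (Euc k)) (P : Measure (Euc d)) (F : Set (Euc k → Euc d))
    (z : Fin n → Euc d) : ℝ≥0∞ :=
  ⨆ f ∈ F, ENNReal.ofReal |risk H P f - risk H (empiricalMeasure z) f|

end

/-! The proof is a direct chaining argument over the reconstruction errors, with Hoeffding's
inequality at every link and one union bound; no symmetrization is used.

The entropy bound comes from Maurey's argument: the mean of `m` signed, scaled basis matrices (or
zeros) approximates any matrix of entrywise ℓ₁ norm at most `M` within `M / √m` in Frobenius norm.
This takes only `(2pq + 1) ^ m` centers, so the dimensions enter through a logarithm. Relative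
errors `1 / √m` in all layers move the net by at most `l / √m` times `∏ L_j M_j ‖h‖`. Projection
does not increase this distance, and passing to the squared distance costs `2 diam Z`. Hence `log
N(ε) ≤ κ² / ε²` for the sup distance on `Z`.

At scale `ε_k ∼ 2⁻ᵏ` an increment has range of order `ε_k` and the cover has entropy `κ² / ε_k²`, so
every level costs the same `κ / √n`. About `log n` levels bring the final scale down to `1 / √n`,
whence the factor `log n`. The confidence terms are summable over the levels. The carrying lemmas
are `ofReal_le_measure_forall_abs_samplingError_le`, `exists_norm_sum_sub_smul_sq_le`,
`norm_denseNet_sub_denseNet_le` and `exists_finset_cover_minError_denseNet`. -/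

/-! ### Sampling errors and Hoeffding's inequality -/

/-- The error `∫ g dP - (1/n) ∑ g(zᵢ)` made by estimating a mean from the sample `z`. -/
noncomputable def samplingError {E : Type*} [MeasurableSpace E] {n : ℕ} (P : Measure E)
    (z : Fin n → E) (g : E → ℝ) : ℝ :=
  ∫ x, g x ∂P - (n : ℝ)⁻¹ * ∑ i, g (z i)

theorem samplingError_sub {E : Type*} [MeasurableSpace E] {n : ℕ} {P : Measure E}
    {z : Fin n → E} {f g : E → ℝ} (hf : Integrable f P) (hg : Integrable g P) :
    samplingError P z (fun x => f x - g x) = samplingError P z f - samplingError P z g := by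
  simp only [samplingError, integral_sub hf hg, Finset.sum_sub_distrib]
  ring

theorem samplingError_neg {E : Type*} [MeasurableSpace E] {n : ℕ} {P : Measure E}
    {z : Fin n → E} {g : E → ℝ} :
    samplingError P z (fun x => -g x) = -samplingError P z g := by
  simp only [samplingError, integral_neg, Finset.sum_neg_distrib]
  ring

theorem abs_samplingError_le {E : Type*} [MeasurableSpace E] {n : ℕ} (hn : 1 ≤ n) {P : Measure E}
    [IsProbabilityMeasure P] {Z : Set E} (hPZ : ∀ᵐ x ∂P, x ∈ Z) {z : Fin n → E}
    (hz : ∀ i, z i ∈ Z) {g : E → ℝ} (hg : AEMeasurable g P) {a b : ℝ}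
    (hgZ : ∀ x ∈ Z, g x ∈ Set.Icc a b) :
    |samplingError P z g| ≤ b - a := by
  have hg' : ∀ᵐ x ∂P, g x ∈ Set.Icc a b := hPZ.mono fun x hx => hgZ x hx
  have hi : Integrable g P := Integrable.of_mem_Icc a b hg hg'
  have hn' : (0 : ℝ) < n := by exact_mod_cast hn
  have h1 : a ≤ ∫ x, g x ∂P := by
    have := integral_mono_ae (integrable_const a) hi (hg'.mono fun x hx => hx.1)
    simpa using this
  have h2 : ∫ x, g x ∂P ≤ b := by
    have := integral_mono_ae hi (integrable_const b) (hg'.mono fun x hx => hx.2)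
    simpa using this
  have h3 : (n : ℝ) * a ≤ ∑ i, g (z i) := by
    have := Finset.card_nsmul_le_sum Finset.univ (fun i => g (z i)) a fun i _ => (hgZ _ (hz i)).1
    simpa using this
  have h4 : ∑ i, g (z i) ≤ (n : ℝ) * b := by
    have := Finset.sum_le_card_nsmul Finset.univ (fun i => g (z i)) b fun i _ => (hgZ _ (hz i)).2
    simpa using this
  have h5 : a ≤ (n : ℝ)⁻¹ * ∑ i, g (z i) := by
    rw [← div_eq_inv_mul, le_div_iff₀ hn']; linarith
  have h6 : (n : ℝ)⁻¹ * ∑ i, g (z i) ≤ b := by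
    rw [← div_eq_inv_mul, div_le_iff₀ hn']; linarith
  rw [samplingError, abs_le]
  constructor <;> linarith

theorem measurable_samplingError {E Ω : Type*} [MeasurableSpace E] [MeasurableSpace Ω] {n : ℕ}
    {P : Measure E} {X : Fin n → Ω → E} (hX : ∀ i, Measurable (X i)) {g : E → ℝ}
    (hg : Measurable g) : Measurable fun ω => samplingError P (fun i => X i ω) g := by
  unfold samplingError
  fun_prop

/-- One-sided Hoeffding inequality for the error of a sample mean. -/
theorem measureReal_samplingError_ge_le {E Ω : Type*} [MeasurableSpace E] [MeasurableSpace Ω]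
    {n : ℕ} (hn : 1 ≤ n) {P : Measure E} {μ : Measure Ω} [IsProbabilityMeasure μ]
    {X : Fin n → Ω → E} (hX : ∀ i, Measurable (X i)) (hXP : ∀ i, μ.map (X i) = P)
    (hXind : iIndepFun X μ) {g : E → ℝ} (hg : Measurable g) {a b : ℝ}
    (hgb : ∀ᵐ x ∂P, g x ∈ Set.Icc a b) {t : ℝ} (ht : 0 ≤ t) :
    μ.real {ω | t ≤ samplingError P (fun i => X i ω) g} ≤
      Real.exp (-(2 * n * t ^ 2 / (b - a) ^ 2)) := by
  have hn' : (0 : ℝ) < n := by exact_mod_cast hn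
  have hsub : ∀ i ∈ Finset.univ, HasSubgaussianMGF (fun ω => ∫ x, g x ∂P - g (X i ω))
      ((‖b - a‖₊ / 2) ^ 2) μ := by
    intro i _
    have hb : ∀ᵐ ω ∂μ, g (X i ω) ∈ Set.Icc a b := by
      rw [← hXP i] at hgb
      exact ae_of_ae_map (hX i).aemeasurable hgb
    have h := (hasSubgaussianMGF_of_mem_Icc (hg.comp (hX i)).aemeasurable hb).neg
    refine h.congr (Filter.Eventually.of_forall fun ω => ?_)
    have hint : ∫ x, g x ∂P = ∫ ω, g (X i ω) ∂μ := by
      rw [← hXP i, integral_map (hX i).aemeasurable hg.aestronglyMeasurable]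
    simp [hint]
  have hind : iIndepFun (fun i ω => ∫ x, g x ∂P - g (X i ω)) μ :=
    hXind.comp (fun _ x => ∫ x, g x ∂P - g x) fun _ => by fun_prop
  have key := HasSubgaussianMGF.measure_sum_ge_le_of_iIndepFun hind hsub
    (mul_nonneg hn'.le ht)
  have hset : {ω | t ≤ samplingError P (fun i => X i ω) g} =
      {ω | n * t ≤ ∑ i, (∫ x, g x ∂P - g (X i ω))} := by
    ext ω
    have : ∑ i, (∫ x, g x ∂P - g (X i ω)) = n * samplingError P (fun i => X i ω) g := by
      simp only [samplingError, Finset.sum_sub_distrib, Finset.sum_const, Finset.card_univ,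
        Fintype.card_fin, nsmul_eq_mul]
      field_simp
    simp only [Set.mem_ofPred_eq, this]
    exact (mul_le_mul_iff_right₀ hn').symm
  rw [hset]
  refine key.trans (le_of_eq ?_)
  congr 1
  have : ((∑ _i : Fin n, (‖b - a‖₊ / 2) ^ 2 : ℝ≥0) : ℝ) = n * ((b - a) ^ 2 / 4) := by
    simp [div_pow]
    norm_num
  push_cast at this ⊢
  rw [this]
  -- If `b = a`, division by zero makes both exponents `0`.
  rcases eq_or_ne (b - a) 0 with h | h
  · simp [h]
  · field_simp
    norm_num

/-- Two-sided Hoeffding inequality for the error of a sample mean. -/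
theorem measureReal_abs_samplingError_ge_le {E Ω : Type*} [MeasurableSpace E] [MeasurableSpace Ω]
    {n : ℕ} (hn : 1 ≤ n) {P : Measure E} {μ : Measure Ω} [IsProbabilityMeasure μ]
    {X : Fin n → Ω → E} (hX : ∀ i, Measurable (X i)) (hXP : ∀ i, μ.map (X i) = P)
    (hXind : iIndepFun X μ) {g : E → ℝ} (hg : Measurable g) {a b : ℝ}
    (hgb : ∀ᵐ x ∂P, g x ∈ Set.Icc a b) {t : ℝ} (ht : 0 ≤ t) :
    μ.real {ω | t ≤ |samplingError P (fun i => X i ω) g|} ≤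
      2 * Real.exp (-(2 * n * t ^ 2 / (b - a) ^ 2)) := by
  have h1 := measureReal_samplingError_ge_le hn hX hXP hXind hg hgb ht
  have h2 := measureReal_samplingError_ge_le hn hX hXP hXind (g := fun x => -g x) hg.neg
    (a := -b) (b := -a)
    (hgb.mono fun x hx => ⟨neg_le_neg hx.2, neg_le_neg hx.1⟩) ht
  have hset : {ω | t ≤ |samplingError P (fun i => X i ω) g|} =
      {ω | t ≤ samplingError P (fun i => X i ω) g} ∪
      {ω | t ≤ samplingError P (fun i => X i ω) (fun x => -g x)} := by
    ext ω
    simp only [samplingError_neg, Set.mem_ofPred_eq, Set.mem_union, le_abs]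
  rw [hset]
  refine (measureReal_union_le _ _).trans ?_
  rw [show -a - -b = b - a by ring] at h2
  linarith

/-! ### Chaining -/

theorem sum_range_two_pow_inv (m : ℕ) :
    ∑ k ∈ Finset.range m, ((2 : ℝ) ^ k)⁻¹ = 2 - 2 * ((2 : ℝ) ^ m)⁻¹ := by
  induction m with
  | zero => simp
  | succ m ih => rw [Finset.sum_range_succ, ih, pow_succ]; field_simp; ring

theorem sum_range_succ_mul_two_pow_inv (m : ℕ) :
    ∑ k ∈ Finset.range m, ((k : ℝ) + 1) * ((2 : ℝ) ^ k)⁻¹ =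
      4 - 2 * (m + 2) * ((2 : ℝ) ^ m)⁻¹ := by
  induction m with
  | zero => norm_num
  | succ m ih => rw [Finset.sum_range_succ, ih, pow_succ]; push_cast; field_simp; ring

/-- The deviation allowed for the increments of the chain at level `k`. -/
noncomputable def chainThreshold (V κ δ : ℝ) (n k : ℕ) : ℝ :=
  V * ((2 : ℝ) ^ k)⁻¹ *
    √((κ ^ 2 / (V / 4 * ((2 : ℝ) ^ k)⁻¹) ^ 2 + Real.log (4 / δ) + k * Real.log 2) / (2 * n))

theorem chainThreshold_nonneg {V : ℝ} (hV : 0 < V) (κ δ : ℝ) (n k : ℕ) :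
    0 ≤ chainThreshold V κ δ n k := by
  unfold chainThreshold; positivity

/-- The three terms under the root each buy one factor: `κ² / ε_k²` pays for the size of the cover,
`log (4 / δ)` absorbs the 2 of the two-sided bound and leaves `δ / 2`, and `k log 2` makes the
failure probabilities summable over the levels, with total at most `δ`. -/
theorem two_mul_exp_chainThreshold {V δ : ℝ} (hV : 0 < V) (hδ0 : 0 < δ) (hδ1 : δ < 1) (κ : ℝ)
    {n : ℕ} (hn : 1 ≤ n) (k : ℕ) :
    2 * Real.exp (-(2 * n * chainThreshold V κ δ n k ^ 2 / (V * ((2 : ℝ) ^ k)⁻¹) ^ 2)) =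
      Real.exp (-(κ ^ 2 / (V / 4 * ((2 : ℝ) ^ k)⁻¹) ^ 2)) * (δ / 2 * ((2 : ℝ) ^ k)⁻¹) := by
  have hn' : (0 : ℝ) < n := by exact_mod_cast hn
  have hlog : 0 ≤ Real.log (4 / δ) := Real.log_nonneg (by rw [le_div_iff₀ hδ0]; linarith)
  have hlog2 : 0 ≤ Real.log 2 := Real.log_nonneg (by norm_num)
  have hr : V * ((2 : ℝ) ^ k)⁻¹ ≠ 0 := by positivity
  rw [chainThreshold, mul_pow _ (√_), Real.sq_sqrt (by positivity)]
  have : ∀ A : ℝ, 2 * (n : ℝ) * ((V * ((2 : ℝ) ^ k)⁻¹) ^ 2 * (A / (2 * n))) /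
      (V * ((2 : ℝ) ^ k)⁻¹) ^ 2 = A := by
    intro A; field_simp
  rw [this, neg_add, neg_add, Real.exp_add, Real.exp_add, Real.exp_neg (Real.log _),
    Real.exp_log (by positivity), Real.exp_neg (_ * _), mul_comm (k : ℝ), Real.exp_mul,
    Real.exp_log (by norm_num), Real.rpow_natCast]
  field_simp
  norm_num

/-- The root is subadditive, and the range `V 2⁻ᵏ = 4 ε_k` cancels the `ε_k` in `κ / ε_k`, so the
entropy part does not depend on `k`. Writing `log (4 / δ) = log 2 + log (2 / δ)` moves one `log 2`
into the summable part. -/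
theorem chainThreshold_le {V κ δ : ℝ} (hV : 0 < V) (hκ : 0 ≤ κ) (hδ0 : 0 < δ) (hδ1 : δ < 1)
    {n : ℕ} (hn : 1 ≤ n) (k : ℕ) :
    chainThreshold V κ δ n k ≤ 4 * κ / √(2 * n) +
      V * √(2 * Real.log (2 / δ) / n) / 2 * ((2 : ℝ) ^ k)⁻¹ +
      V / √n * ((k + 1) * ((2 : ℝ) ^ k)⁻¹) := by
  have hn' : (0 : ℝ) < n := by exact_mod_cast hn
  have hlog : 0 ≤ Real.log (2 / δ) := Real.log_nonneg (by rw [le_div_iff₀ hδ0]; linarith)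
  have hlog2 : 0 ≤ Real.log 2 := Real.log_nonneg (by norm_num)
  have hlog2' : Real.log 2 ≤ 1 := by linarith [Real.log_two_lt_d9]
  have hsqrt : ∀ x y : ℝ, 0 ≤ x → 0 ≤ y → √(x + y) ≤ √x + √y := fun x y hx hy => by
    rw [Real.sqrt_le_left (by positivity), add_sq, Real.sq_sqrt hx, Real.sq_sqrt hy]
    have : 0 ≤ 2 * √x * √y := by positivity
    linarith
  set ε : ℝ := V / 4 * ((2 : ℝ) ^ k)⁻¹ with hε
  have hε0 : 0 < ε := by positivity
  have hsplit : (κ ^ 2 / ε ^ 2 + Real.log (4 / δ) + k * Real.log 2) / (2 * n) =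
      (κ / ε) ^ 2 / (2 * n) + (2 * Real.log (2 / δ) / n) / 2 ^ 2 +
        ((k + 1) * Real.log 2 / 2) / n := by
    rw [show (4 : ℝ) / δ = 2 * (2 / δ) by ring, Real.log_mul (by norm_num) (by positivity)]
    field_simp
    ring
  have h3 : √(((k + 1) * Real.log 2 / 2) / n) ≤ (k + 1) / √n := by
    rw [Real.sqrt_div (by positivity)]
    gcongr
    rw [Real.sqrt_le_left (by positivity)]
    have : (0 : ℝ) ≤ k := by positivity
    nlinarith
  have key : √((κ ^ 2 / ε ^ 2 + Real.log (4 / δ) + k * Real.log 2) / (2 * n)) ≤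
      κ / ε / √(2 * n) + √(2 * Real.log (2 / δ) / n) / 2 + (k + 1) / √n := by
    rw [hsplit]
    refine (hsqrt _ _ (by positivity) (by positivity)).trans (add_le_add ?_ h3)
    refine (hsqrt _ _ (by positivity) (by positivity)).trans (add_le_add ?_ ?_)
    · rw [Real.sqrt_div (by positivity), Real.sqrt_sq (by positivity)]
    · rw [Real.sqrt_div (by positivity) (2 ^ 2), Real.sqrt_sq (by norm_num)]
  calc chainThreshold V κ δ n k
      ≤ V * ((2 : ℝ) ^ k)⁻¹ *
        (κ / ε / √(2 * n) + √(2 * Real.log (2 / δ) / n) / 2 + (k + 1) / √n) :=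
        mul_le_mul_of_nonneg_left key (by positivity)
    _ = _ := by
        have : V * ((2 : ℝ) ^ k)⁻¹ * (κ / ε) = 4 * κ := by rw [hε]; field_simp
        rw [mul_add, mul_add, ← mul_div_assoc, this]
        ring

/-- The confidence series sums to at most 2 and the series of `(k + 1) 2⁻ᵏ` to at most 4; the
residual `2 ε_K` adds at most one more `V / √n` because `√n ≤ 2 ^ K`. The constant 8 has slack. -/
theorem sum_chainThreshold_le {V κ δ : ℝ} (hV : 0 < V) (hκ : 0 ≤ κ) (hδ0 : 0 < δ) (hδ1 : δ < 1)
    {n : ℕ} (hn : 1 ≤ n) {K : ℕ} (hK : n ≤ 4 ^ K) :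
    ∑ k ∈ Finset.range (K + 1), chainThreshold V κ δ n k + 2 * (V / 4 * ((2 : ℝ) ^ K)⁻¹) ≤
      4 * κ * (K + 1) / √(2 * n) + 8 * V / √n + V * √(2 * Real.log (2 / δ) / n) := by
  have hn' : (0 : ℝ) < n := by exact_mod_cast hn
  have h1 := Finset.sum_le_sum fun k (_ : k ∈ Finset.range (K + 1)) =>
    chainThreshold_le hV hκ hδ0 hδ1 hn k
  rw [Finset.sum_add_distrib, Finset.sum_add_distrib, ← Finset.mul_sum, ← Finset.mul_sum,
    sum_range_two_pow_inv, sum_range_succ_mul_two_pow_inv] at h1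
  simp only [Finset.sum_const, Finset.card_range, nsmul_eq_mul, Nat.cast_add, Nat.cast_one] at h1
  have h2 : V * √(2 * Real.log (2 / δ) / n) / 2 * (2 - 2 * ((2 : ℝ) ^ (K + 1))⁻¹) ≤
      V * √(2 * Real.log (2 / δ) / n) / 2 * 2 := by
    gcongr
    have : (0 : ℝ) ≤ 2 * ((2 : ℝ) ^ (K + 1))⁻¹ := by positivity
    linarith
  have h3 : V / √n * (4 - 2 * ((K : ℝ) + 1 + 2) * ((2 : ℝ) ^ (K + 1))⁻¹) ≤ V / √n * 4 := by
    gcongr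
    have : (0 : ℝ) ≤ 2 * ((K : ℝ) + 1 + 2) * ((2 : ℝ) ^ (K + 1))⁻¹ := by positivity
    linarith
  have h4 : 2 * (V / 4 * ((2 : ℝ) ^ K)⁻¹) ≤ V / √n := by
    have h5 : √(n : ℝ) ≤ 2 ^ K := by
      rw [Real.sqrt_le_left (by positivity), ← pow_mul, mul_comm, pow_mul]
      norm_num
      exact_mod_cast hK
    have h6 : ((2 : ℝ) ^ K)⁻¹ ≤ (√(n : ℝ))⁻¹ := inv_anti₀ (by positivity) h5
    have h7 : 0 ≤ V * (√(n : ℝ))⁻¹ := by positivity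
    rw [div_eq_mul_inv V (√n)]
    linarith [mul_le_mul_of_nonneg_left h6 hV.le]
  have h7 : 0 ≤ V / √(n : ℝ) := by positivity
  have h8 : 8 * V / √(n : ℝ) = 8 * (V / √n) := by ring
  have h9 : 4 * κ * (K + 1) / √(2 * (n : ℝ)) = (K + 1) * (4 * κ / √(2 * n)) := by ring
  rw [h8, h9]
  linarith

/-- A chaining bound for a class of functions with values in `[0, V]` whose uniform covering
numbers satisfy `log N(ε) ≤ κ² / ε²`. -/
theorem ofReal_le_measure_forall_abs_samplingError_le {E Ω ι : Type*} [MeasurableSpace E]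
    [MeasurableSpace Ω] {n : ℕ} (hn : 1 ≤ n) {P : Measure E} [IsProbabilityMeasure P]
    {Z : Set E} (hPZ : ∀ᵐ x ∂P, x ∈ Z) {μ : Measure Ω} [IsProbabilityMeasure μ]
    {X : Fin n → Ω → E} (hX : ∀ i, Measurable (X i)) (hXP : ∀ i, μ.map (X i) = P)
    (hXind : iIndepFun X μ) {e : ι → E → ℝ} (he : ∀ i, Measurable (e i)) {V : ℝ} (hV : 0 < V)
    (heZ : ∀ i, ∀ x ∈ Z, e i x ∈ Set.Icc 0 V) {κ : ℝ} (hκ : 0 ≤ κ)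
    (hcover : ∀ ε : ℝ, 0 < ε → ∃ T : Finset ι, (T.card : ℝ) ≤ Real.exp (κ ^ 2 / ε ^ 2) ∧
      ∀ i, ∃ j ∈ T, ∀ x ∈ Z, |e i x - e j x| ≤ ε)
    {K : ℕ} (hK : n ≤ 4 ^ K) {δ : ℝ} (hδ0 : 0 < δ) (hδ1 : δ < 1) :
    ENNReal.ofReal (1 - δ) ≤ μ {ω | ∀ i, |samplingError P (fun m => X m ω) (e i)| ≤
      4 * κ * (K + 1) / √(2 * n) + 8 * V / √n + V * √(2 * Real.log (2 / δ) / n)} := by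
  have hεpos : ∀ k : ℕ, 0 < V / 4 * ((2 : ℝ) ^ k)⁻¹ := fun k => by positivity
  choose T hTcard hT using fun k : ℕ => hcover _ (hεpos k)
  choose p hpT hp using hT
  -- The chain starts from the zero function. The predecessor of `i` is a function of `i`, so the
  -- union bound at level `k` runs over `T k` and not over pairs.
  let prev : ℕ → ι → E → ℝ := fun k i => k.casesOn 0 fun k => e (p k i)
  have hprev : ∀ k i, Measurable (prev k i) := by
    rintro (_ | k) i
    · exact measurable_zero
    · exact he _
  have hint : ∀ i, Integrable (e i) P := fun i =>
    Integrable.of_mem_Icc 0 V (he i).aemeasurable (hPZ.mono (heZ i))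
  have hprevint : ∀ k i, Integrable (prev k i) P := by
    rintro (_ | k) i
    · exact integrable_zero _ _ _
    · exact hint _
  -- The factor 1/4 in the scales makes level `k + 1` fit the pattern of level `0`: twice `V / 4 *
  -- 2⁻ᵏ` is `V * 2⁻⁽ᵏ⁺¹⁾`.
  have hrange : ∀ k i, ∃ a b : ℝ, b - a = V * ((2 : ℝ) ^ k)⁻¹ ∧
      ∀ x ∈ Z, e i x - prev k i x ∈ Set.Icc a b := by
    rintro (_ | k) i
    · exact ⟨0, V, by simp, fun x hx => by simpa [prev] using heZ i x hx⟩
    · refine ⟨-(V / 4 * ((2 : ℝ) ^ k)⁻¹), V / 4 * ((2 : ℝ) ^ k)⁻¹, ?_, fun x hx => ?_⟩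
      · rw [pow_succ]; field_simp; norm_num
      · exact abs_le.1 (hp k i x hx)
  let bad : ℕ → ι → Set Ω := fun k i => {ω | chainThreshold V κ δ n k ≤
    |samplingError P (fun m => X m ω) (fun x => e i x - prev k i x)|}
  have hbadmeas : ∀ k i, MeasurableSet (bad k i) := fun k i =>
    measurableSet_le measurable_const
      (measurable_samplingError hX ((he i).sub (hprev k i))).abs
  have hbad : ∀ k i, μ.real (bad k i) ≤
      Real.exp (-(κ ^ 2 / (V / 4 * ((2 : ℝ) ^ k)⁻¹) ^ 2)) * (δ / 2 * ((2 : ℝ) ^ k)⁻¹) := by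
    intro k i
    obtain ⟨a, b, hab, hmem⟩ := hrange k i
    have := measureReal_abs_samplingError_ge_le hn hX hXP hXind ((he i).sub (hprev k i))
      (hPZ.mono hmem) (chainThreshold_nonneg hV κ δ n k)
    rw [hab, two_mul_exp_chainThreshold hV hδ0 hδ1 κ hn k] at this
    exact this
  let B : Set Ω := ⋃ k ∈ Finset.range (K + 1), ⋃ i ∈ T k, bad k i
  have hBmeas : MeasurableSet B :=
    Finset.measurableSet_biUnion _ fun k _ => Finset.measurableSet_biUnion _ fun i _ =>
      hbadmeas k i
  have hB : μ.real B ≤ δ := by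
    calc μ.real B ≤ ∑ k ∈ Finset.range (K + 1), μ.real (⋃ i ∈ T k, bad k i) :=
          measureReal_biUnion_finset_le _ _
      _ ≤ ∑ k ∈ Finset.range (K + 1), δ / 2 * ((2 : ℝ) ^ k)⁻¹ := by
          refine Finset.sum_le_sum fun k _ => ?_
          calc μ.real (⋃ i ∈ T k, bad k i) ≤ ∑ i ∈ T k, μ.real (bad k i) :=
                measureReal_biUnion_finset_le _ _
            _ ≤ (T k).card * (Real.exp (-(κ ^ 2 / (V / 4 * ((2 : ℝ) ^ k)⁻¹) ^ 2)) *
                  (δ / 2 * ((2 : ℝ) ^ k)⁻¹)) := by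
                rw [← nsmul_eq_mul]
                exact Finset.sum_le_card_nsmul _ _ _ fun i _ => hbad k i
            _ ≤ Real.exp (κ ^ 2 / (V / 4 * ((2 : ℝ) ^ k)⁻¹) ^ 2) *
                  (Real.exp (-(κ ^ 2 / (V / 4 * ((2 : ℝ) ^ k)⁻¹) ^ 2)) *
                  (δ / 2 * ((2 : ℝ) ^ k)⁻¹)) :=
                mul_le_mul_of_nonneg_right (hTcard k) (by positivity)
            _ = δ / 2 * ((2 : ℝ) ^ k)⁻¹ := by
                rw [← mul_assoc, ← Real.exp_add, add_neg_cancel, Real.exp_zero, one_mul]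
      _ ≤ δ := by
          rw [← Finset.mul_sum, sum_range_two_pow_inv]
          have : 0 ≤ δ * ((2 : ℝ) ^ (K + 1))⁻¹ := by positivity
          linarith
  have hXZ : ∀ᵐ ω ∂μ, ∀ m, X m ω ∈ Z := ae_all_iff.2 fun m => by
    rw [← hXP m] at hPZ
    exact ae_of_ae_map (hX m).aemeasurable hPZ
  have hcompl : ENNReal.ofReal (1 - δ) ≤ μ Bᶜ := by
    rw [← ofReal_measureReal, probReal_compl_eq_one_sub hBmeas]
    exact ENNReal.ofReal_le_ofReal (by linarith)
  -- The index type may be uncountable, so the target event need not be measurable; it contains, up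
  -- to a null set, the measurable event `Bᶜ`.
  refine hcompl.trans (measure_mono_ae ?_)
  filter_upwards [hXZ] with ω hω hωB i
  have hgood : ∀ k ≤ K, ∀ i ∈ T k,
      |samplingError P (fun m => X m ω) (e i) - samplingError P (fun m => X m ω) (prev k i)| ≤
        chainThreshold V κ δ n k := by
    intro k hk i hi
    rw [← samplingError_sub (hint i) (hprevint k i)]
    by_contra hlt
    exact hωB (Set.mem_biUnion (Finset.mem_coe.2 (Finset.mem_range.2 (Nat.lt_succ_of_le hk)))
      (Set.mem_biUnion (Finset.mem_coe.2 hi) (not_le.1 hlt).le))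
  have hchain : ∀ k ≤ K, ∀ i ∈ T k, |samplingError P (fun m => X m ω) (e i)| ≤
      ∑ j ∈ Finset.range (k + 1), chainThreshold V κ δ n j := by
    intro k
    induction k with
    | zero =>
      intro hk i hi
      have := hgood 0 hk i hi
      simpa [prev, samplingError] using this
    | succ k ih =>
      intro hk i hi
      rw [Finset.sum_range_succ]
      have h1 := hgood (k + 1) hk i hi
      have h2 := ih (by omega) (p k i) (hpT k i)
      have h3 := abs_sub_abs_le_abs_sub (samplingError P (fun m => X m ω) (e i))
        (samplingError P (fun m => X m ω) (prev (k + 1) i))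
      change |samplingError P (fun m => X m ω) (prev (k + 1) i)| ≤ _ at h2
      linarith
  -- The last link, from an arbitrary index to `T K`, needs no probability: the uniform distance
  -- `ε_K` costs at most `2 ε_K`.
  have h1 := hchain K le_rfl (p K i) (hpT K i)
  have h2 := abs_samplingError_le hn hPZ hω ((he i).sub (he (p K i))).aemeasurable
    fun x hx => abs_le.1 (hp K i x hx)
  have h3 := abs_sub_abs_le_abs_sub (samplingError P (fun m => X m ω) (e i))
    (samplingError P (fun m => X m ω) (e (p K i)))
  have h4 : samplingError P (fun m => X m ω) (e i - e (p K i)) = _ :=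
    samplingError_sub (hint i) (hint (p K i))
  rw [h4] at h2
  have h5 := sum_chainThreshold_le hV hκ hδ0 hδ1 hn hK
  linarith

/-! ### Maurey's lemma and covers of the ℓ₁ ball -/

/-- Maurey's sparsification lemma: a point of the convex hull of a set of radius `M` is the mean
of `m` points of the set up to an error of `M / √m`. -/
theorem exists_norm_sum_sub_smul_sq_le {E : Type*} [NormedAddCommGroup E] [InnerProductSpace ℝ E]
    {V : Set E} {M : ℝ} (hV : ∀ v ∈ V, ‖v‖ ≤ M) {x : E} (hx : x ∈ convexHull ℝ V) (m : ℕ) :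
    ∃ v : Fin m → E, (∀ i, v i ∈ V) ∧ ‖∑ i, v i - (m : ℝ) • x‖ ^ 2 ≤ m * M ^ 2 := by
  induction m with
  | zero => exact ⟨Fin.elim0, fun i => i.elim0, by simp⟩
  | succ m ih =>
    obtain ⟨v, hvV, hv⟩ := ih
    set s : E := ∑ i, v i - (m : ℝ) • x with hs
    -- A greedy choice replaces the random one: on a convex hull a linear functional is at least its
    -- value at some generating point. The resulting inequality bounds the new square by `‖s‖² -
    -- ‖x‖² + ‖y‖²`, so each step adds at most `M²`.
    obtain ⟨y, hyV, hy⟩ := (((innerSL ℝ (s - x)).toLinearMap.concaveOn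
      (convex_univ (𝕜 := ℝ) (E := E)))).exists_le_of_mem_convexHull (Set.subset_univ V) hx
    have hy' : inner ℝ (s - x) y ≤ inner ℝ (s - x) x := hy
    refine ⟨Fin.cons y v, fun i => ?_, ?_⟩
    · refine Fin.cases ?_ (fun i => ?_) i
      · simpa using hyV
      · simpa using hvV i
    · have h1 : ∑ i, (Fin.cons y v : Fin (m + 1) → E) i - ((m + 1 : ℕ) : ℝ) • x = (s - x) + y := by
        rw [Fin.sum_univ_succ]
        simp only [Fin.cons_zero, Fin.cons_succ, hs]
        push_cast
        rw [add_smul, one_smul]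
        abel
      have h2 : ‖s‖ ^ 2 = ‖s - x‖ ^ 2 + 2 * inner ℝ (s - x) x + ‖x‖ ^ 2 := by
        rw [← norm_add_sq_real, sub_add_cancel]
      have h3 : ‖y‖ ^ 2 ≤ M ^ 2 := pow_le_pow_left₀ (norm_nonneg _) (hV y hyV) 2
      rw [h1, norm_add_sq_real]
      push_cast
      nlinarith [sq_nonneg ‖x‖]

/-- The extreme points `±M eᵢ` of the `ℓ₁` ball of radius `M`, together with its center. -/
noncomputable def l1Vertex {ι : Type*} [DecidableEq ι] (M : ℝ) :
    Option (ι × Bool) → EuclideanSpace ℝ ι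
  | none => 0
  | some (i, b) => EuclideanSpace.single i (if b then M else -M)

theorem sum_abs_l1Vertex_le {ι : Type*} [Fintype ι] [DecidableEq ι] {M : ℝ} (hM : 0 ≤ M)
    (a : Option (ι × Bool)) : ∑ i, |l1Vertex M a i| ≤ M := by
  rcases a with _ | ⟨j, b⟩
  · simpa [l1Vertex] using hM
  · rw [Finset.sum_eq_single j]
    · cases b <;> simp [l1Vertex, abs_of_nonneg hM]
    · intro i _ hij
      simp [l1Vertex, hij]
    · simp

theorem norm_l1Vertex_le {ι : Type*} [Fintype ι] [DecidableEq ι] {M : ℝ} (hM : 0 ≤ M)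
    (a : Option (ι × Bool)) : ‖l1Vertex M a‖ ≤ M := by
  rcases a with _ | ⟨j, b⟩
  · simpa [l1Vertex] using hM
  · cases b <;> simp [l1Vertex, abs_of_nonneg hM]

/-- The vertex with the sign of `x i` gets weight `|x i| / M`, and the center takes up the missing
mass. -/
theorem mem_convexHull_range_l1Vertex {ι : Type*} [Fintype ι] [DecidableEq ι] {M : ℝ} (hM : 0 < M)
    {x : EuclideanSpace ℝ ι} (hx : ∑ i, |x i| ≤ M) :
    x ∈ convexHull ℝ (Set.range (l1Vertex (ι := ι) M)) := by
  let w : Option ι → ℝ := fun o => o.elim (1 - ∑ i, |x i| / M) fun i => |x i| / M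
  let a : Option ι → Option (ι × Bool) := fun o => o.map fun i => (i, decide (0 ≤ x i))
  have hsum : ∑ o, w o • l1Vertex M (a o) = x := by
    rw [Fintype.sum_option]
    simp only [w, a, l1Vertex, Option.map_none, Option.map_some, Option.elim_some,
      smul_zero, zero_add]
    ext j
    rw [WithLp.ofLp_sum, Finset.sum_apply, Finset.sum_eq_single j]
    · by_cases h : 0 ≤ x j
      · simp [h, abs_of_nonneg h, hM.ne']
      · simp [h, abs_of_neg (not_le.1 h), hM.ne']
    · intro i _ hij
      simp [hij.symm]
    · simp
  rw [← hsum]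
  refine (convex_convexHull ℝ _).sum_mem ?_ ?_ fun o _ => subset_convexHull ℝ _ ⟨a o, rfl⟩
  · rintro (_ | i) _
    · simp only [w, Option.elim_none, ← Finset.sum_div, sub_nonneg]
      exact (div_le_one hM).2 hx
    · simp only [w, Option.elim_some]
      positivity
  · rw [Fintype.sum_option]
    simp [w]

/-- The centers are all means of `m` vertices, counted by the choice functions. They stay in the
ball, so they are again admissible parameters. -/
theorem exists_finset_cover_l1Ball {ι : Type*} [Fintype ι] [DecidableEq ι] {M : ℝ} (hM : 0 < M)
    {m : ℕ} (hm : 1 ≤ m) :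
    ∃ T : Finset (EuclideanSpace ℝ ι), T.card ≤ (2 * Fintype.card ι + 1) ^ m ∧
      (∀ y ∈ T, ∑ i, |y i| ≤ M) ∧
      ∀ x : EuclideanSpace ℝ ι, ∑ i, |x i| ≤ M → ∃ y ∈ T, ‖x - y‖ ≤ M / √m := by
  classical
  have hm' : (0 : ℝ) < m := by exact_mod_cast hm
  let center : (Fin m → Option (ι × Bool)) → EuclideanSpace ℝ ι := fun c =>
    (m : ℝ)⁻¹ • ∑ k, l1Vertex M (c k)
  refine ⟨Finset.univ.image center, ?_, ?_, ?_⟩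
  · refine Finset.card_image_le.trans (le_of_eq ?_)
    rw [Finset.card_univ, Fintype.card_fun, Fintype.card_option, Fintype.card_prod,
      Fintype.card_bool, Fintype.card_fin, mul_comm]
  · intro y hy
    obtain ⟨c, -, rfl⟩ := Finset.mem_image.1 hy
    calc ∑ i, |center c i| ≤ ∑ i, (m : ℝ)⁻¹ * ∑ k, |l1Vertex M (c k) i| := by
          refine Finset.sum_le_sum fun i _ => ?_
          have : center c i = (m : ℝ)⁻¹ * ∑ k, l1Vertex M (c k) i := by simp [center]
          rw [this, abs_mul, abs_of_pos (inv_pos.2 hm')]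
          exact mul_le_mul_of_nonneg_left (Finset.abs_sum_le_sum_abs _ _) (by positivity)
      _ = (m : ℝ)⁻¹ * ∑ k, ∑ i, |l1Vertex M (c k) i| := by
          rw [← Finset.mul_sum, Finset.sum_comm]
      _ ≤ (m : ℝ)⁻¹ * (m * M) := by
          refine mul_le_mul_of_nonneg_left ?_ (by positivity)
          simpa using Finset.sum_le_card_nsmul Finset.univ
            (fun k => ∑ i, |l1Vertex M (c k) i|) M fun k _ => sum_abs_l1Vertex_le hM.le _
      _ = M := by field_simp
  · intro x hx
    have hV : ∀ v ∈ Set.range (l1Vertex (ι := ι) M), ‖v‖ ≤ M :=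
      Set.forall_mem_range.2 fun a => norm_l1Vertex_le hM.le a
    obtain ⟨v, hv, hbound⟩ := exists_norm_sum_sub_smul_sq_le hV
      (mem_convexHull_range_l1Vertex hM hx) m
    choose c hc using hv
    refine ⟨center c, Finset.mem_image_of_mem _ (Finset.mem_univ c), ?_⟩
    have h1 : x - center c = -((m : ℝ)⁻¹ • (∑ k, v k - (m : ℝ) • x)) := by
      simp only [center, hc, smul_sub, smul_smul, inv_mul_cancel₀ hm'.ne', one_smul, neg_sub]
    rw [h1, norm_neg, norm_smul, Real.norm_of_nonneg (by positivity)]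
    have h2 : ‖∑ k, v k - (m : ℝ) • x‖ ≤ √m * M := by
      refine (pow_le_pow_iff_left₀ (norm_nonneg _) (by positivity) two_ne_zero).1 ?_
      rw [mul_pow, Real.sq_sqrt hm'.le]
      exact hbound
    calc (m : ℝ)⁻¹ * ‖∑ k, v k - (m : ℝ) • x‖ ≤ (m : ℝ)⁻¹ * (√m * M) :=
          mul_le_mul_of_nonneg_left h2 (by positivity)
      _ = M / √m := by
          have : √(m : ℝ) * √m = m := Real.mul_self_sqrt hm'.le
          have h0 : 0 < √(m : ℝ) := Real.sqrt_pos.2 hm'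
          rw [eq_div_iff h0.ne',
            show (m : ℝ)⁻¹ * (√m * M) * √m = (m : ℝ)⁻¹ * (√m * √m) * M by ring, this,
            inv_mul_cancel₀ hm'.ne', one_mul]

/-! ### Matrix norms and covers of one layer -/

/-- The Frobenius norm of a matrix. -/
noncomputable def frobNorm {p q : ℕ} (A : Matrix (Fin p) (Fin q) ℝ) : ℝ :=
  √(∑ i, ∑ j, A i j ^ 2)

theorem frobNorm_nonneg {p q : ℕ} (A : Matrix (Fin p) (Fin q) ℝ) : 0 ≤ frobNorm A :=
  Real.sqrt_nonneg _

theorem frobNorm_le_entrywiseL1 {p q : ℕ} (A : Matrix (Fin p) (Fin q) ℝ) :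
    frobNorm A ≤ entrywiseL1 A := by
  have h0 : 0 ≤ entrywiseL1 A := Finset.sum_nonneg fun i _ => Finset.sum_nonneg fun j _ =>
    abs_nonneg _
  rw [frobNorm, Real.sqrt_le_left h0, entrywiseL1]
  rw [← Fintype.sum_prod_type' (fun i j => A i j ^ 2), ← Fintype.sum_prod_type' (fun i j => |A i j|)]
  simp_rw [← sq_abs (A _ _)]
  exact Finset.sum_sq_le_sq_sum_of_nonneg fun _ _ => abs_nonneg _

theorem norm_mulVec_le_frobNorm {p q : ℕ} (A : Matrix (Fin p) (Fin q) ℝ) (ξ : Euc q) :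
    ‖(WithLp.toLp 2 (A *ᵥ ξ.ofLp) : Euc p)‖ ≤ frobNorm A * ‖ξ‖ := by
  rw [EuclideanSpace.norm_eq, EuclideanSpace.norm_eq, frobNorm, ← Real.sqrt_mul (by positivity)]
  refine Real.sqrt_le_sqrt ?_
  rw [Finset.sum_mul]
  refine Finset.sum_le_sum fun i _ => ?_
  simp only [Real.norm_eq_abs, sq_abs, Matrix.mulVec, dotProduct]
  exact Finset.sum_mul_sq_le_sq_mul_sq _ _ _

theorem exists_finset_cover_entrywiseL1 {p q : ℕ} {M : ℝ} (hM : 0 < M) {m : ℕ} (hm : 1 ≤ m) :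
    ∃ T : Finset (Matrix (Fin p) (Fin q) ℝ), T.card ≤ (2 * (p * q) + 1) ^ m ∧
      (∀ B ∈ T, entrywiseL1 B ≤ M) ∧
      ∀ A, entrywiseL1 A ≤ M → ∃ B ∈ T, frobNorm (A - B) ≤ M / √m := by
  classical
  obtain ⟨T, hcard, hT, hcov⟩ := exists_finset_cover_l1Ball (ι := Fin p × Fin q) hM hm
  refine ⟨T.image fun y => Matrix.of fun i j => y (i, j), ?_, ?_, ?_⟩
  · refine Finset.card_image_le.trans (hcard.trans (le_of_eq ?_))
    simp
  · intro B hB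
    obtain ⟨y, hy, rfl⟩ := Finset.mem_image.1 hB
    have := hT y hy
    rwa [Fintype.sum_prod_type] at this
  · intro A hA
    obtain ⟨y, hy, hxy⟩ := hcov (WithLp.toLp 2 fun ij => A ij.1 ij.2)
      (by rw [Fintype.sum_prod_type]; exact hA)
    refine ⟨_, Finset.mem_image_of_mem _ hy, ?_⟩
    rw [EuclideanSpace.norm_eq, Fintype.sum_prod_type] at hxy
    simpa [frobNorm] using hxy

/-! ### Stability of the projection and of the net -/

theorem inner_sub_projOnto_le_zero {m : ℕ} {Z : Set (Euc m)} (hne : Z.Nonempty)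
    (hcl : IsClosed Z) (hconv : Convex ℝ Z) (ξ : Euc m) {z : Euc m} (hz : z ∈ Z) :
    inner ℝ (ξ - projOnto Z ξ) (z - projOnto Z ξ) ≤ 0 := by
  have h := isNearestPoint_projOnto hne hcl ξ
  have : Nonempty Z := hne.to_subtype
  refine (norm_eq_iInf_iff_real_inner_le_zero hconv h.1).1 (le_antisymm ?_ ?_) z hz
  · exact le_ciInf fun z => h.2 z z.2
  · exact ciInf_le ⟨0, by rintro _ ⟨z, rfl⟩; positivity⟩ (⟨_, h.1⟩ : Z)

/-- Adding the variational inequalities at the two projections gives `‖a - b‖² ≤ ⟪ξ - η, a - b⟫`;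
Cauchy–Schwarz finishes. -/
theorem norm_projOnto_sub_projOnto_le {m : ℕ} {Z : Set (Euc m)} (hne : Z.Nonempty)
    (hcl : IsClosed Z) (hconv : Convex ℝ Z) (ξ η : Euc m) :
    ‖projOnto Z ξ - projOnto Z η‖ ≤ ‖ξ - η‖ := by
  have h1 := inner_sub_projOnto_le_zero hne hcl hconv ξ (isNearestPoint_projOnto hne hcl η).1
  have h2 := inner_sub_projOnto_le_zero hne hcl hconv η (isNearestPoint_projOnto hne hcl ξ).1
  set a := projOnto Z ξ
  set b := projOnto Z η
  have h3 : inner ℝ (ξ - a) (b - a) + inner ℝ (η - b) (a - b) =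
      ‖a - b‖ ^ 2 - inner ℝ (ξ - η) (a - b) := by
    rw [← real_inner_self_eq_norm_sq, ← neg_sub a b, inner_neg_right, ← sub_eq_neg_add,
      ← inner_sub_left, ← inner_sub_left]
    congr 1
    abel
  have h4 := real_inner_le_norm (ξ - η) (a - b)
  by_contra! h
  nlinarith [norm_nonneg (ξ - η), norm_nonneg (a - b)]

theorem denseNet_zero {w : ℕ → ℕ} {σ : ∀ j, Euc (w (j + 1)) → Euc (w (j + 1))}
    {A : ∀ j, Matrix (Fin (w (j + 1))) (Fin (w j)) ℝ} (h : Euc (w 0)) :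
    denseNet w σ A 0 h = h := rfl

/-- Since each activation fixes `0`, its Lipschitz bound is also a growth bound. -/
theorem norm_denseNet_le {w : ℕ → ℕ} {σ : ∀ j, Euc (w (j + 1)) → Euc (w (j + 1))} {L : ℕ → ℝ≥0}
    {M : ℕ → ℝ} {A : ∀ j, Matrix (Fin (w (j + 1))) (Fin (w j)) ℝ} (h : Euc (w 0)) (l : ℕ)
    (hσ : ∀ j < l, LipschitzWith (L j) (σ j)) (hσ0 : ∀ j < l, σ j 0 = 0)
    (hM : ∀ j < l, 0 ≤ M j) (hA : ∀ j < l, entrywiseL1 (A j) ≤ M j) :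
    ‖denseNet w σ A l h‖ ≤ (∏ j ∈ Finset.range l, (L j : ℝ) * M j) * ‖h‖ := by
  induction l with
  | zero => simp [denseNet_zero]
  | succ l ih =>
    specialize ih (fun j hj => hσ j (by omega)) (fun j hj => hσ0 j (by omega))
      (fun j hj => hM j (by omega)) (fun j hj => hA j (by omega))
    have hl := l.lt_succ_self
    set b := denseNet w σ A l h with hb
    have h1 : ‖denseNet w σ A (l + 1) h‖ ≤
        L l * ‖(WithLp.toLp 2 (A l *ᵥ b.ofLp) : Euc (w (l + 1)))‖ := by
      have := (hσ l hl).norm_sub_le (WithLp.toLp 2 (A l *ᵥ b.ofLp)) 0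
      rwa [hσ0 l hl, sub_zero, sub_zero] at this
    calc ‖denseNet w σ A (l + 1) h‖
        ≤ L l * ‖(WithLp.toLp 2 (A l *ᵥ b.ofLp) : Euc (w (l + 1)))‖ := h1
      _ ≤ L l * (M l * ((∏ j ∈ Finset.range l, (L j : ℝ) * M j) * ‖h‖)) := by
          refine mul_le_mul_of_nonneg_left ?_ (L l).coe_nonneg
          refine (norm_mulVec_le_frobNorm _ _).trans ?_
          exact mul_le_mul ((frobNorm_le_entrywiseL1 _).trans (hA l hl)) ih (norm_nonneg _)
            (hM l hl)
      _ = _ := by rw [Finset.prod_range_succ]; ring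

/-- The splitting `A a - B b = A (a - b) + (A - B) b` separates the inherited error from the new
one. With errors measured relative to `M j`, each layer contributes the same amount, hence the
factor `l`. -/
theorem norm_denseNet_sub_denseNet_le {w : ℕ → ℕ}
    {σ : ∀ j, Euc (w (j + 1)) → Euc (w (j + 1))} {L : ℕ → ℝ≥0}
    {M : ℕ → ℝ} {A B : ∀ j, Matrix (Fin (w (j + 1))) (Fin (w j)) ℝ} (h : Euc (w 0)) (l : ℕ)
    (hσ : ∀ j < l, LipschitzWith (L j) (σ j)) (hσ0 : ∀ j < l, σ j 0 = 0)
    (hM : ∀ j < l, 0 ≤ M j) (hA : ∀ j < l, entrywiseL1 (A j) ≤ M j)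
    (hB : ∀ j < l, entrywiseL1 (B j) ≤ M j) {η : ℝ}
    (hAB : ∀ j < l, frobNorm (A j - B j) ≤ η * M j) :
    ‖denseNet w σ A l h - denseNet w σ B l h‖ ≤
      l * η * ((∏ j ∈ Finset.range l, (L j : ℝ) * M j) * ‖h‖) := by
  induction l with
  | zero => simp [denseNet_zero]
  | succ l ih =>
    specialize ih (fun j hj => hσ j (by omega)) (fun j hj => hσ0 j (by omega))
      (fun j hj => hM j (by omega)) (fun j hj => hA j (by omega)) (fun j hj => hB j (by omega))
      (fun j hj => hAB j (by omega))
    have hbb := norm_denseNet_le (A := B) h l (fun j hj => hσ j (by omega))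
      (fun j hj => hσ0 j (by omega)) (fun j hj => hM j (by omega)) (fun j hj => hB j (by omega))
    have hl := l.lt_succ_self
    set a := denseNet w σ A l h with ha
    set b := denseNet w σ B l h with hb
    set Q := (∏ j ∈ Finset.range l, (L j : ℝ) * M j) * ‖h‖ with hQ
    have h1 : ‖denseNet w σ A (l + 1) h - denseNet w σ B (l + 1) h‖ ≤
        L l * ‖(WithLp.toLp 2 (A l *ᵥ a.ofLp) : Euc (w (l + 1))) -
          WithLp.toLp 2 (B l *ᵥ b.ofLp)‖ := (hσ l hl).norm_sub_le _ _
    have h2 : (WithLp.toLp 2 (A l *ᵥ a.ofLp) : Euc (w (l + 1))) - WithLp.toLp 2 (B l *ᵥ b.ofLp) =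
        WithLp.toLp 2 (A l *ᵥ (a - b).ofLp) + WithLp.toLp 2 ((A l - B l) *ᵥ b.ofLp) := by
      rw [← WithLp.toLp_sub, ← WithLp.toLp_add, WithLp.ofLp_sub, Matrix.mulVec_sub,
        Matrix.sub_mulVec]
      congr 1
      abel
    calc ‖denseNet w σ A (l + 1) h - denseNet w σ B (l + 1) h‖
        ≤ L l * (M l * (l * η * Q) + η * M l * Q) := by
          refine h1.trans (mul_le_mul_of_nonneg_left ?_ (L l).coe_nonneg)
          rw [h2]
          refine (norm_add_le _ _).trans (add_le_add ?_ ?_)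
          · refine (norm_mulVec_le_frobNorm _ _).trans ?_
            exact mul_le_mul ((frobNorm_le_entrywiseL1 _).trans (hA l hl)) ih (norm_nonneg _)
              (hM l hl)
          · refine (norm_mulVec_le_frobNorm _ _).trans ?_
            exact mul_le_mul (hAB l hl) hbb (norm_nonneg _) ((frobNorm_nonneg _).trans (hAB l hl))
      _ = _ := by
          rw [Finset.prod_range_succ, hQ]
          push_cast
          ring

/-! ### The reconstruction error -/

theorem bddBelow_range_norm_sub_sq {k d : ℕ} (H : Set (Euc k)) (f : Euc k → Euc d) (z : Euc d) :
    BddBelow (Set.range fun h : H => ‖z - f h‖ ^ 2) :=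
  ⟨0, by rintro _ ⟨h, rfl⟩; positivity⟩

/-- The infimum may be uncountable and `f` arbitrary, but an infimum of functions continuous in `z`
is upper semicontinuous. -/
theorem measurable_minError {k d : ℕ} (H : Set (Euc k)) (f : Euc k → Euc d) :
    Measurable (minError H f) := by
  refine UpperSemicontinuous.measurable ?_
  refine upperSemicontinuous_ciInf (f := fun (h : H) z => ‖z - f h‖ ^ 2)
    (bddBelow_range_norm_sub_sq H f) fun h => ?_
  exact Continuous.upperSemicontinuous (by fun_prop)

theorem minError_mem_Icc {k d : ℕ} {H : Set (Euc k)} (hHne : H.Nonempty) {f : Euc k → Euc d}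
    {Z : Set (Euc d)} (hZ : Bornology.IsBounded Z) (hf : ∀ h, f h ∈ Z) {z : Euc d} (hz : z ∈ Z) :
    minError H f z ∈ Set.Icc 0 (Metric.diam Z ^ 2) := by
  obtain ⟨h, hh⟩ := hHne
  refine ⟨Real.iInf_nonneg fun h => by positivity, ?_⟩
  refine (ciInf_le (bddBelow_range_norm_sub_sq H f z) ⟨h, hh⟩).trans ?_
  refine pow_le_pow_left₀ (norm_nonneg _) ?_ 2
  rw [← dist_eq_norm]
  exact Metric.dist_le_diam_of_mem hZ hz (hf h)

/-- A difference of squares factors, and the sum of the two distances is at most `2 diam Z`. -/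
theorem minError_sub_minError_le {k d : ℕ} {H : Set (Euc k)} (hHne : H.Nonempty)
    {f g : Euc k → Euc d} {Z : Set (Euc d)} (hZ : Bornology.IsBounded Z) (hf : ∀ h, f h ∈ Z)
    (hg : ∀ h, g h ∈ Z) {z : Euc d} (hz : z ∈ Z) {c : ℝ} (hc : ∀ h ∈ H, ‖f h - g h‖ ≤ c) :
    minError H f z - minError H g z ≤ 2 * Metric.diam Z * c := by
  have : Nonempty H := hHne.to_subtype
  rw [sub_le_comm]
  refine le_ciInf fun h => ?_
  have h1 : minError H f z ≤ ‖z - f h‖ ^ 2 := ciInf_le (bddBelow_range_norm_sub_sq H f z) h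
  have h2 : ‖z - f h‖ ≤ Metric.diam Z := by
    rw [← dist_eq_norm]; exact Metric.dist_le_diam_of_mem hZ hz (hf h)
  have h3 : ‖z - g h‖ ≤ Metric.diam Z := by
    rw [← dist_eq_norm]; exact Metric.dist_le_diam_of_mem hZ hz (hg h)
  have h4 : ‖z - f h‖ - ‖z - g h‖ ≤ c := by
    have := norm_sub_norm_le (z - f h) (z - g h)
    rw [sub_sub_sub_cancel_left, norm_sub_rev (g h)] at this
    exact this.trans (hc h h.2)
  have h5 : 0 ≤ c := (norm_nonneg _).trans (hc h h.2)
  have h6 : (‖z - f h‖ - ‖z - g h‖) * (‖z - f h‖ + ‖z - g h‖) ≤ c * (2 * Metric.diam Z) :=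
    mul_le_mul h4 (by linarith) (by positivity) h5
  linarith

theorem abs_minError_sub_minError_le {k d : ℕ} {H : Set (Euc k)} (hHne : H.Nonempty)
    {f g : Euc k → Euc d} {Z : Set (Euc d)} (hZ : Bornology.IsBounded Z) (hf : ∀ h, f h ∈ Z)
    (hg : ∀ h, g h ∈ Z) {z : Euc d} (hz : z ∈ Z) {c : ℝ} (hc : ∀ h ∈ H, ‖f h - g h‖ ≤ c) :
    |minError H f z - minError H g z| ≤ 2 * Metric.diam Z * c :=
  abs_sub_le_iff.2 ⟨minError_sub_minError_le hHne hZ hf hg hz hc,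
    minError_sub_minError_le hHne hZ hg hf hz fun h hh => norm_sub_rev (f h) (g h) ▸ hc h hh⟩

theorem norm_le_supNorm {m : ℕ} {U : Set (Euc m)} (hU : Bornology.IsBounded U) {u : Euc m}
    (hu : u ∈ U) : ‖u‖ ≤ supNorm U := by
  obtain ⟨C, hC⟩ := hU.exists_norm_le
  exact le_ciSup (f := fun u : U => ‖(u : Euc m)‖)
    ⟨C, by rintro _ ⟨u, rfl⟩; exact hC u u.2⟩ ⟨u, hu⟩

theorem supNorm_nonneg {m : ℕ} (U : Set (Euc m)) : 0 ≤ supNorm U :=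
  Real.iSup_nonneg fun _ => norm_nonneg _

theorem integral_empiricalMeasure {d n : ℕ} (z : Fin n → Euc d) (g : Euc d → ℝ) :
    ∫ x, g x ∂(empiricalMeasure z) = (n : ℝ)⁻¹ * ∑ i, g (z i) := by
  rw [empiricalMeasure, integral_smul_measure,
    integral_finsetSum_measure fun i _ => integrable_dirac (by simp)]
  simp

theorem risk_sub_risk_empiricalMeasure {k d n : ℕ} (H : Set (Euc k)) (P : Measure (Euc d))
    (f : Euc k → Euc d) (z : Fin n → Euc d) :
    risk H P f - risk H (empiricalMeasure z) f = samplingError P z (minError H f) := by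
  rw [risk, risk, integral_empiricalMeasure, samplingError]

/-! ### Covers of the class of nets -/

/-- The weights of a net of depth `l` whose layers have entrywise `ℓ₁` norms at most `M j`. -/
abbrev BoundedWeights (w : ℕ → ℕ) (l : ℕ) (M : ℕ → ℝ) : Type :=
  {A : ∀ j, Matrix (Fin (w (j + 1))) (Fin (w j)) ℝ // ∀ j < l, entrywiseL1 (A j) ≤ M j}

/-- The cover is a product over the layers. With the same `m` in each of them, the relative errors
agree and the log-cardinalities add up. -/
theorem exists_finset_cover_weights (w : ℕ → ℕ) (l : ℕ) {M : ℕ → ℝ} (hM : ∀ j < l, 0 < M j)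
    {m : ℕ} (hm : 1 ≤ m) :
    ∃ T : Finset (BoundedWeights w l M),
      (T.card : ℝ) ≤ Real.exp
        (m * ∑ j ∈ Finset.range l, Real.log (2 * (w j : ℝ) * (w (j + 1) : ℝ) + 1)) ∧
      ∀ A : BoundedWeights w l M, ∃ B ∈ T, ∀ j < l, frobNorm (A.1 j - B.1 j) ≤ 1 / √m * M j := by
  classical
  choose T hcard hT hcov using fun j : Fin l =>
    exists_finset_cover_entrywiseL1 (p := w (j + 1)) (q := w j) (hM j j.2) hm
  -- Only the first `l` matrices matter, so the others are set to `0` and do not enlarge the cover.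
  let extend : (∀ j : Fin l, Matrix (Fin (w (j + 1))) (Fin (w j)) ℝ) →
      ∀ j, Matrix (Fin (w (j + 1))) (Fin (w j)) ℝ := fun c j => if hj : j < l then c ⟨j, hj⟩ else 0
  have hext : ∀ c j (hj : j < l), extend c j = c ⟨j, hj⟩ := fun c j hj => dif_pos hj
  have hmem : ∀ c ∈ Fintype.piFinset T, ∀ j < l, entrywiseL1 (extend c j) ≤ M j := by
    intro c hc j hj
    rw [hext c j hj]
    exact hT ⟨j, hj⟩ _ (Fintype.mem_piFinset.1 hc ⟨j, hj⟩)
  let toWeights : {c // c ∈ Fintype.piFinset T} → BoundedWeights w l M :=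
    fun c => ⟨extend c.1, hmem c.1 c.2⟩
  refine ⟨(Fintype.piFinset T).attach.image toWeights, ?_, ?_⟩
  · have h1 : (((Fintype.piFinset T).card : ℕ) : ℝ) ≤
        ∏ j : Fin l, (2 * (w j : ℝ) * (w (j + 1) : ℝ) + 1) ^ m := by
      rw [Fintype.card_piFinset, Nat.cast_prod]
      refine Finset.prod_le_prod (fun _ _ => Nat.cast_nonneg _) fun j _ => ?_
      refine (Nat.cast_le.2 (hcard j)).trans (le_of_eq ?_)
      push_cast
      ring
    have h2 : Real.exp
        (m * ∑ j ∈ Finset.range l, Real.log (2 * (w j : ℝ) * (w (j + 1) : ℝ) + 1)) =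
        ∏ j : Fin l, (2 * (w j : ℝ) * (w (j + 1) : ℝ) + 1) ^ m := by
      rw [Finset.mul_sum, Real.exp_sum, Finset.prod_range]
      refine Finset.prod_congr rfl fun j _ => ?_
      rw [Real.exp_nat_mul, Real.exp_log (by positivity)]
    rw [h2]
    refine le_trans (Nat.cast_le.2 Finset.card_image_le) ?_
    rwa [Finset.card_attach]
  · intro A
    choose c hcT hc using fun j : Fin l => hcov j (A.1 j) (A.2 j j.2)
    refine ⟨toWeights ⟨c, Fintype.mem_piFinset.2 hcT⟩,
      Finset.mem_image_of_mem _ (Finset.mem_attach _ _), fun j hj => ?_⟩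
    change frobNorm (A.1 j - extend c j) ≤ _
    rw [hext c j hj, one_div_mul_eq_div]
    exact hc ⟨j, hj⟩

theorem abs_minError_denseNet_sub_le {l : ℕ} {w : ℕ → ℕ}
    {σ : ∀ j, Euc (w (j + 1)) → Euc (w (j + 1))} {L : ℕ → ℝ≥0}
    (hσ : ∀ j < l, LipschitzWith (L j) (σ j)) (hσ0 : ∀ j < l, σ j 0 = 0)
    {M : ℕ → ℝ} (hM : ∀ j < l, 0 < M j) {H : Set (Euc (w 0))} (hH : IsCompact H)
    (hHne : H.Nonempty) {Z : Set (Euc (w l))} (hZ : IsCompact Z) (hZconv : Convex ℝ Z)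
    (hZne : Z.Nonempty) {A B : ∀ j, Matrix (Fin (w (j + 1))) (Fin (w j)) ℝ}
    (hA : ∀ j < l, entrywiseL1 (A j) ≤ M j) (hB : ∀ j < l, entrywiseL1 (B j) ≤ M j) {η : ℝ}
    (hη : 0 ≤ η) (hAB : ∀ j < l, frobNorm (A j - B j) ≤ η * M j) {z : Euc (w l)} (hz : z ∈ Z) :
    |minError H (fun h => projOnto Z (denseNet w σ A l h)) z -
      minError H (fun h => projOnto Z (denseNet w σ B l h)) z| ≤
      2 * Metric.diam Z * l * ((∏ j ∈ Finset.range l, (L j : ℝ) * M j) * supNorm H) * η := by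
  have hprod : 0 ≤ ∏ j ∈ Finset.range l, (L j : ℝ) * M j := Finset.prod_nonneg fun j hj =>
    mul_nonneg (L j).coe_nonneg (hM j (Finset.mem_range.1 hj)).le
  have hproj : ∀ ξ, projOnto Z ξ ∈ Z := fun ξ => (isNearestPoint_projOnto hZne hZ.isClosed ξ).1
  refine (abs_minError_sub_minError_le hHne hZ.isBounded (fun h => hproj _) (fun h => hproj _) hz
    (c := l * η * ((∏ j ∈ Finset.range l, (L j : ℝ) * M j) * supNorm H))
    fun h hh => ?_).trans (le_of_eq (by ring))
  refine (norm_projOnto_sub_projOnto_le hZne hZ.isClosed hZconv _ _).trans ?_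
  refine (norm_denseNet_sub_denseNet_le h l hσ hσ0 (fun j hj => (hM j hj).le) hA hB hAB).trans ?_
  have := norm_le_supNorm hH.isBounded hh
  gcongr

theorem exists_finset_cover_minError_denseNet {l : ℕ} {w : ℕ → ℕ}
    {σ : ∀ j, Euc (w (j + 1)) → Euc (w (j + 1))} {L : ℕ → ℝ≥0}
    (hσ : ∀ j < l, LipschitzWith (L j) (σ j)) (hσ0 : ∀ j < l, σ j 0 = 0)
    {M : ℕ → ℝ} (hM : ∀ j < l, 0 < M j) {H : Set (Euc (w 0))} (hH : IsCompact H)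
    (hHne : H.Nonempty) {Z : Set (Euc (w l))} (hZ : IsCompact Z) (hZconv : Convex ℝ Z)
    (hZne : Z.Nonempty) {ε : ℝ} (hε : 0 < ε) :
    ∃ T : Finset (BoundedWeights w l M),
      (T.card : ℝ) ≤ Real.exp
        ((√2 * (2 * Metric.diam Z * l * ((∏ j ∈ Finset.range l, (L j : ℝ) * M j) * supNorm H)) *
          √(∑ j ∈ Finset.range l, Real.log (2 * (w j : ℝ) * (w (j + 1) : ℝ) + 1))) ^ 2 /
          ε ^ 2) ∧
      ∀ A : BoundedWeights w l M, ∃ B ∈ T, ∀ z ∈ Z, |minError H (fun h => projOnto Z (denseNet w σ A.1 l h)) z -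
        minError H (fun h => projOnto Z (denseNet w σ B.1 l h)) z| ≤ ε := by
  set S : ℝ := ∑ j ∈ Finset.range l, Real.log (2 * (w j : ℝ) * (w (j + 1) : ℝ) + 1) with hS
  have hS0 : 0 ≤ S := Finset.sum_nonneg fun j _ => Real.log_nonneg (by
    have : (0 : ℝ) ≤ 2 * (w j : ℝ) * (w (j + 1) : ℝ) := by positivity
    linarith)
  set a : ℝ := 2 * Metric.diam Z * l * ((∏ j ∈ Finset.range l, (L j : ℝ) * M j) * supNorm H)
    with ha
  -- At scales `ε ≥ a` the zero weights alone form a cover, with relative error `η = 1`. Below that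
  -- `(a / ε)² ≥ 1`, so rounding it up to an integer at most doubles it; this is the `√2` in the
  -- entropy constant.
  rcases le_or_gt a ε with haε | haε
  · refine ⟨{⟨fun j => 0, fun j hj => by simpa [entrywiseL1] using (hM j hj).le⟩}, ?_, ?_⟩
    · rw [Finset.card_singleton, Nat.cast_one]
      exact Real.one_le_exp (by positivity)
    · refine fun A => ⟨_, Finset.mem_singleton_self _, fun z hz => le_trans ?_ haε⟩
      have := abs_minError_denseNet_sub_le hσ hσ0 hM hH hHne hZ hZconv hZne A.2
        (B := fun j => 0) (fun j hj => by simpa [entrywiseL1] using (hM j hj).le) zero_le_one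
        (fun j hj => by
          rw [sub_zero, one_mul]
          exact (frobNorm_le_entrywiseL1 _).trans (A.2 j hj)) hz
      rwa [← ha, mul_one] at this
  · have ha0 : 0 < a := hε.trans haε
    have h1 : 1 ≤ (a / ε) ^ 2 := one_le_pow₀ ((one_le_div hε).2 haε.le)
    set m : ℕ := ⌈(a / ε) ^ 2⌉₊ with hm
    have hm1 : 1 ≤ m := Nat.one_le_ceil_iff.2 (by linarith)
    have hm2 : (m : ℝ) ≤ 2 * (a / ε) ^ 2 := by
      have := Nat.ceil_lt_add_one (a := (a / ε) ^ 2) (by positivity)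
      linarith
    have hm3 : a / ε ≤ √m := Real.le_sqrt_of_sq_le (Nat.le_ceil _)
    have hm0 : 0 < √(m : ℝ) := Real.sqrt_pos.2 (by exact_mod_cast hm1)
    obtain ⟨T, hcard, hT⟩ := exists_finset_cover_weights w l hM hm1
    refine ⟨T, hcard.trans (Real.exp_le_exp.2 ?_), fun A => ?_⟩
    · rw [mul_pow, mul_pow, Real.sq_sqrt hS0, Real.sq_sqrt zero_le_two]
      calc (m : ℝ) * S ≤ 2 * (a / ε) ^ 2 * S := mul_le_mul_of_nonneg_right hm2 hS0
        _ = _ := by ring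
    · obtain ⟨B, hBT, hB⟩ := hT A
      refine ⟨B, hBT, fun z hz => ?_⟩
      refine (abs_minError_denseNet_sub_le hσ hσ0 hM hH hHne hZ hZconv hZne A.2 B.2
        (by positivity) hB hz).trans ?_
      rw [← ha, mul_one_div, div_le_iff₀ hm0]
      rw [div_le_iff₀ hε] at hm3
      linarith

/-- Cover centers need not lie in the sets `𝒜 j`, so the chaining runs over the full ℓ₁ balls and is
restricted to the class only here. -/
theorem genError_denseNetClass_le {l : ℕ} {w : ℕ → ℕ}
    {σ : ∀ j, Euc (w (j + 1)) → Euc (w (j + 1))} {M : ℕ → ℝ}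
    {𝒜 : ∀ j, Set (Matrix (Fin (w (j + 1))) (Fin (w j)) ℝ)}
    (h𝒜 : ∀ j < l, ∀ A ∈ 𝒜 j, entrywiseL1 A ≤ M j) {H : Set (Euc (w 0))}
    {Z : Set (Euc (w l))} {P : Measure (Euc (w l))} {n : ℕ} {z : Fin n → Euc (w l)} {c : ℝ}
    (hc : ∀ A : BoundedWeights w l M,
      |samplingError P z (minError H fun h => projOnto Z (denseNet w σ A.1 l h))| ≤ c) :
    genError H P (denseNetClass w l σ 𝒜 Z) z ≤ ENNReal.ofReal c := by
  refine iSup₂_le fun f hf => ENNReal.ofReal_le_ofReal ?_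
  obtain ⟨A, hA, rfl⟩ := hf
  rw [risk_sub_risk_empiricalMeasure]
  exact hc ⟨A, fun j hj => h𝒜 j hj _ (hA j hj)⟩

/-! ### Assembly of the bound -/

theorem mainTheorem4
    -- depth, widths (`w 0 = k` is the latent and `w l = d` the data dimension), activations
    (l : ℕ) (hl : 1 ≤ l) (w : ℕ → ℕ)
    (σ : ∀ j, Euc (w (j + 1)) → Euc (w (j + 1)))
    (L : ℕ → ℝ≥0) (hσ : ∀ j < l, LipschitzWith (L j) (σ j)) (hσ0 : ∀ j < l, σ j 0 = 0)
    -- the parameter sets of the layers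
    (M : ℕ → ℝ) (hM : ∀ j < l, 0 < M j)
    (𝒜 : ∀ j, Set (Matrix (Fin (w (j + 1))) (Fin (w j)) ℝ))
    (h𝒜 : ∀ j < l, ∀ A ∈ 𝒜 j, entrywiseL1 A ≤ M j)
    -- the codebook and the data space
    (H : Set (Euc (w 0))) (hH : IsCompact H) (hHne : H.Nonempty)
    (Z : Set (Euc (w l))) (hZ : IsCompact Z) (hZconv : Convex ℝ Z) (hZ0 : (0 : Euc (w l)) ∈ Z)
    -- the data-generating distribution and `n` independent samples drawn from it
    (P : Measure (Euc (w l))) [IsProbabilityMeasure P] (hPZ : ∀ᵐ z ∂P, z ∈ Z)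
    (n : ℕ) (hn : 1 ≤ n)
    {Ω : Type*} [MeasurableSpace Ω] (μ : Measure Ω) [IsProbabilityMeasure μ]
    (X : Fin n → Ω → Euc (w l)) (hX : ∀ i, Measurable (X i))
    (hXP : ∀ i, Measure.map (X i) μ = P) (hXind : iIndepFun X μ)
    (δ : ℝ) (hδ0 : 0 < δ) (hδ1 : δ < 1) :
    ENNReal.ofReal (1 - δ) ≤
      μ {ω | genError H P (denseNetClass w l σ 𝒜 Z) (fun i => X i ω) ≤
        ENNReal.ofReal
          (48 * √2 * (l : ℝ) * Real.log n / √(n : ℝ) * Metric.diam Z * supNorm H *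
              (∏ j ∈ Finset.range l, (L j : ℝ) * M j) *
              √(∑ j ∈ Finset.range l, Real.log (2 * (w j : ℝ) * (w (j + 1) : ℝ) + 1))
            + 8 * Metric.diam Z ^ 2 / √(n : ℝ)
            + Metric.diam Z ^ 2 * √(2 * Real.log (2 / δ) / (n : ℝ)))} := by
  have hZne : Z.Nonempty := ⟨0, hZ0⟩
  have hn0 : (0 : ℝ) < n := by exact_mod_cast hn
  have hlogn : 0 ≤ Real.log n := Real.log_natCast_nonneg n
  have hB0 : 0 ≤ ∏ j ∈ Finset.range l, (L j : ℝ) * M j := Finset.prod_nonneg fun j hj =>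
    mul_nonneg (L j).coe_nonneg (hM j (Finset.mem_range.1 hj)).le
  have hsup0 := supNorm_nonneg H
  have hproj : ∀ ξ, projOnto Z ξ ∈ Z := fun ξ => (isNearestPoint_projOnto hZne hZ.isClosed ξ).1
  have hD0 : 0 ≤ Metric.diam Z := Metric.diam_nonneg
  set D : ℝ := Metric.diam Z with hD
  set S : ℝ := ∑ j ∈ Finset.range l, Real.log (2 * (w j : ℝ) * (w (j + 1) : ℝ) + 1) with hS
  set R : ℝ := ∏ j ∈ Finset.range l, (L j : ℝ) * M j with hR
  have hXZ : ∀ᵐ ω ∂μ, ∀ m, X m ω ∈ Z := ae_all_iff.2 fun m => by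
    rw [← hXP m] at hPZ
    exact ae_of_ae_map (hX m).aemeasurable hPZ
  have hrange : ∀ A : ∀ j, Matrix (Fin (w (j + 1))) (Fin (w j)) ℝ, ∀ z ∈ Z,
      minError H (fun h => projOnto Z (denseNet w σ A l h)) z ∈ Set.Icc 0 (D ^ 2) :=
    fun A z hz => minError_mem_Icc hHne hZ.isBounded (fun h => hproj _) hz
  -- For `n = 1` the factor `log n` vanishes, and for `D = 0` chaining lacks a positive range `V`.
  -- In both cases the trivial bound `D ^ 2` is already below `8 * D ^ 2 / √n`.
  by_cases htriv : n = 1 ∨ D = 0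
  · refine le_trans (b := 1) (ENNReal.ofReal_le_one.2 (by linarith)) ?_
    rw [← measure_univ (μ := μ)]
    refine measure_mono_ae ?_
    filter_upwards [hXZ] with ω hω _
    refine genError_denseNetClass_le h𝒜 fun A => ?_
    refine (abs_samplingError_le hn hPZ hω (measurable_minError H _).aemeasurable
      (hrange A.1)).trans ?_
    have h1 : 0 ≤ 48 * √2 * (l : ℝ) * Real.log n / √(n : ℝ) * D * supNorm H * R * √S := by
      positivity
    have h2 : 0 ≤ D ^ 2 * √(2 * Real.log (2 / δ) / (n : ℝ)) := by positivity
    have h3 : D ^ 2 ≤ 8 * D ^ 2 / √(n : ℝ) := by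
      rcases htriv with h | h
      · rw [h, Nat.cast_one, Real.sqrt_one, div_one]
        nlinarith [sq_nonneg D]
      · simp [h]
    linarith
  · rw [not_or] at htriv
    have hDpos : 0 < D := lt_of_le_of_ne hD0 (Ne.symm htriv.2)
    have hn2 : 2 ≤ n := by omega
    have hlog2 : Real.log 2 ≤ Real.log n :=
      Real.log_le_log two_pos (by exact_mod_cast hn2)
    have hlog2' := Real.log_two_gt_d9
    -- The depth `⌈log n⌉` suffices because `e < 4`.
    have hK : n ≤ 4 ^ ⌈Real.log n⌉₊ := by
      have h1 : (n : ℝ) ≤ 4 ^ ⌈Real.log n⌉₊ := by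
        calc (n : ℝ) = Real.exp (Real.log n) := (Real.exp_log hn0).symm
          _ ≤ Real.exp (⌈Real.log n⌉₊ * 1) := by
              rw [mul_one]; exact Real.exp_le_exp.2 (Nat.le_ceil _)
          _ = Real.exp 1 ^ ⌈Real.log n⌉₊ := Real.exp_nat_mul _ _
          _ ≤ 4 ^ ⌈Real.log n⌉₊ := by
              gcongr
              linarith [Real.exp_one_lt_d9]
      exact_mod_cast h1
    have hK' := (Nat.ceil_lt_add_one hlogn).le
    set a : ℝ := 2 * D * l * (R * supNorm H) with ha
    have ha0 : 0 ≤ a := by positivity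
    have key := ofReal_le_measure_forall_abs_samplingError_le hn hPZ hX hXP hXind
      (e := fun A : BoundedWeights w l M =>
        minError H fun h => projOnto Z (denseNet w σ A.1 l h))
      (fun A => measurable_minError H _) (V := D ^ 2) (by positivity) (fun A => hrange A.1)
      (κ := √2 * a * √S) (by positivity)
      (fun ε hε => exists_finset_cover_minError_denseNet hσ hσ0 hM hH hHne hZ hZconv hZne hε)
      hK hδ0 hδ1
    refine key.trans (measure_mono fun ω hω => genError_denseNetClass_le h𝒜 fun A =>
      (hω A).trans ?_)
    -- The `√2` of `κ` cancels that of `√(2n)`. Since `log n ≥ log 2 > 0.69`, `4 (⌈log n⌉ + 1) ≤ 4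
    -- log n + 8 ≤ 24 √2 log n`; the factor 2 in `a` turns 24 into 48.
    have h1 : 4 * (√2 * a * √S) * (⌈Real.log n⌉₊ + 1) / √(2 * (n : ℝ)) ≤
        48 * √2 * (l : ℝ) * Real.log n / √(n : ℝ) * D * supNorm H * R * √S := by
      have hs2 : 0 < √(2 : ℝ) := by positivity
      have hs2' : 1 ≤ √(2 : ℝ) := Real.one_le_sqrt.2 one_le_two
      calc 4 * (√2 * a * √S) * (⌈Real.log n⌉₊ + 1) / √(2 * (n : ℝ))
          = a * √S / √n * (4 * (⌈Real.log n⌉₊ + 1)) := by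
            rw [Real.sqrt_mul zero_le_two]; field_simp
        _ ≤ a * √S / √n * (24 * √2 * Real.log n) := by
            refine mul_le_mul_of_nonneg_left ?_ (by positivity)
            nlinarith
        _ = _ := by rw [ha]; ring
    linarith
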